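/- Let $\Omega \subset \mathbb{R}^n$ be a bounded Lipschitz domain (a nonempty, bounded, connected open set which, near each of its boundary points and after a rigid motion, is the region above the graph of a Lipschitz function of $n-1$ variables), and let $\Sigma \subset \partial\Omega$ be nonempty and closed. Let $u \in H^1_0(\Omega)$ and $\rho \in L^\infty(\Omega)$ be real-valued, where $H^1_0(\Omega)$ is the closure of $C_c^\infty(\Omega)$ in $H^1(\Omega)$. Let $\mathrm{Diff}^1_c(\mathbb{R}^n)$ be the group of $C^1$ diffeomorphisms $\varphi$ of $\mathbb{R}^n$ for which the closure of $\{x : \varphi(x) \neq x\}$ is compact, with the weak $C^1$ topology, i.e. the topology generated by the sets $\{\psi : \|\psi-\varphi\|_{C^1(K)} < \varepsilon\}$ with $\varphi \in \mathrm{Diff}^1_c(\mathbb{R}^n)$, $K \subset \mathbb{R}^n$ compact, $\varepsilon > 0$, where $\|f\|_{C^1(K)} = \sum_{|\alpha| \le 1} \sup_K |\partial^\alpha f|$. Let $\mathfrak{X}^1_c(\mathbb{R}^n)$ be the space of compactly supported $C^1$ vector fields on $\mathbb{R}^n$. A function $H : \mathrm{Diff}^1_c(\mathbb{R}^n) \to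 \mathbb{R}$ is called Gateaux differentiable if it is continuous and if, for all $\varphi \in \mathrm{Diff}^1_c(\mathbb{R}^n)$ and $\xi \in \mathfrak{X}^1_c(\mathbb{R}^n)$, one has $\varphi + t\xi \in \mathrm{Diff}^1_c(\mathbb{R}^n)$ for all sufficiently small $|t|$ and the derivative $D_\varphi H(\xi) = \frac{d}{dt}\big|_{t=0} H(\varphi + t\xi)$ exists. Write $d_A(y) = \inf_{a \in A} |y-a|$. Then the integral $$G(\varphi) = \int_\Omega \frac{u(x)^2 \rho(x)}{d_{\varphi(\Sigma)}(\varphi(x))^2}\, dx$$ converges absolutely for every $\varphi \in \mathrm{Diff}^1_c(\mathbb{R}^n)$, and the function $G : \mathrm{Diff}^1_c(\mathbb{R}^n) \to \mathbb{R}$ is Gateaux differentiable. Moreover, for every $\varphi \in \mathrm{Diff}^1_c(\mathbb{R}^n)$ and almost every $x \in \Omega$ there is exactly one point $\sigma(x) \in \Sigma$ with $d_{\varphi(\Sigma)}(\varphi(x)) = |\varphi(x) - \varphi(\sigma(x))|$, and for every $\xi \in \mathfrak{X}^1_c(\mathbb{R}^n)$ $$D_\varphi G(\xi) = -2 \int_\Omega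 \frac{u(x)^2 \rho(x)\, (\varphi(x) - \varphi(\sigma(x))) \cdot (\xi(x) - \xi(\sigma(x)))}{d_{\varphi(\Sigma)}(\varphi(x))^4}\, dx,$$ the integral on the right converging absolutely. -/

import Mathlib

open MeasureTheory Filter Topology
open scoped ENNReal ContDiff

namespace HardyShape

noncomputable section

/-- Euclidean `n`-space. -/
abbrev Eucl (n : ℕ) := EuclideanSpace ℝ (Fin n)

/-- The `i`-th partial derivative. -/
def partialDeriv {n : ℕ} {F : Type*} [NormedAddCommGroup F] [NormedSpace ℝ F]
    (i : Fin n) (f : Eucl n → F) (x : Eucl n) : F :=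
  fderiv ℝ f x (EuclideanSpace.single i 1)

/-! ### Bounded Lipschitz domains -/

/-- A bounded Lipschitz domain: a bounded, connected, nonempty open set which near each of its
boundary points is, for a suitable choice of the "vertical" unit direction `ν`, the region above the
graph of a Lipschitz function of the horizontal variable `x - ⟪ν, x⟫ ν` (only the values of `f` on
the hyperplane orthogonal to `ν` matter). -/
structure IsBoundedLipschitzDomain {n : ℕ} (Ω : Set (Eucl n)) : Prop where
  isOpen : IsOpen Ω
  isConnected : IsConnected Ω
  isBounded : Bornology.IsBounded Ω
  lipschitz_boundary : ∀ p ∈ frontier Ω, ∃ ν : Eucl n, ‖ν‖ = 1 ∧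
    ∃ (f : Eucl n → ℝ) (K : NNReal), LipschitzWith K f ∧ ∃ r : ℝ, 0 < r ∧
      ∀ x ∈ Metric.ball p r, (x ∈ Ω ↔ f (x - inner ℝ ν x • ν) < inner ℝ ν x)

/-! ### The space `H¹₀(Ω)` -/

/-- `ψ ∈ C_c^∞(Ω)`. -/
structure IsTestFunction {n : ℕ} (Ω : Set (Eucl n)) (ψ : Eucl n → ℝ) : Prop where
  smooth : ContDiff ℝ ∞ ψ
  hasCompactSupport : HasCompactSupport ψ
  tsupport_subset : tsupport ψ ⊆ Ω

/-- `g` is the weak (distributional) gradient of `u` in `Ω`. -/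
def IsWeakGradient {n : ℕ} (Ω : Set (Eucl n)) (u : Eucl n → ℝ) (g : Eucl n → Eucl n) : Prop :=
  ∀ ψ, IsTestFunction Ω ψ → ∀ i : Fin n,
    ∫ x in Ω, u x * partialDeriv i ψ x = -∫ x in Ω, g x i * ψ x

/-- `u ∈ H¹₀(Ω)`, the closure of `C_c^∞(Ω)` in `H¹(Ω)`: `u` is in `L²(Ω)` with a weak gradient `g`
in `L²(Ω)`, and `(u, g)` is a limit in `L²(Ω)` of pairs `(ψ, ∇ψ)` with `ψ ∈ C_c^∞(Ω)`.
Only the values of `u` on `Ω`, up to null sets, matter. -/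
def MemH10 {n : ℕ} (Ω : Set (Eucl n)) (u : Eucl n → ℝ) : Prop :=
  MemLp u 2 (volume.restrict Ω) ∧ ∃ g : Eucl n → Eucl n,
    MemLp g 2 (volume.restrict Ω) ∧ IsWeakGradient Ω u g ∧
    ∀ ε : ℝ≥0∞, 0 < ε → ∃ ψ, IsTestFunction Ω ψ ∧
      eLpNorm (fun x => u x - ψ x) 2 (volume.restrict Ω) < ε ∧
      eLpNorm (fun x => g x - gradient ψ x) 2 (volume.restrict Ω) < ε

/-! ### Compactly supported `C¹` diffeomorphisms and vector fields -/

/-- `Diff¹_c(ℝⁿ)`: the `C¹` diffeomorphisms of `ℝⁿ` that are the identity off a compact set. -/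
structure Diff1c (n : ℕ) where
  toHomeomorph : Eucl n ≃ₜ Eucl n
  contDiff : ContDiff ℝ 1 toHomeomorph
  contDiff_symm : ContDiff ℝ 1 toHomeomorph.symm
  isCompact_support : IsCompact (closure {x | toHomeomorph x ≠ x})

instance {n : ℕ} : CoeFun (Diff1c n) (fun _ => Eucl n → Eucl n) := ⟨fun φ => φ.toHomeomorph⟩

/-- `𝔛¹_c(ℝⁿ)`: the compactly supported `C¹` vector fields. -/
structure IsC1cField {n : ℕ} (ξ : Eucl n → Eucl n) : Prop where
  contDiff : ContDiff ℝ 1 ξ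
  hasCompactSupport : HasCompactSupport ξ

/-- The `C¹(K)` norm: the sum over `|α| ≤ 1` of the suprema over `K` of `|∂^α f|`. -/
def c1Norm {n : ℕ} (K : Set (Eucl n)) (f : Eucl n → Eucl n) : ℝ :=
  (⨆ x : K, ‖f x‖) + ∑ i : Fin n, ⨆ x : K, ‖partialDeriv i f x‖

/-- The basic set with centre `φ`, domain `K` and radius `ε`. -/
def c1Ball {n : ℕ} (φ : Diff1c n) (K : Set (Eucl n)) (ε : ℝ) : Set (Diff1c n) :=
  {ψ | c1Norm K (fun x => ψ x - φ x) < ε}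

/-- The weak (compact-open) `C¹` topology on `Diff¹_c(ℝⁿ)`. -/
instance {n : ℕ} : TopologicalSpace (Diff1c n) :=
  TopologicalSpace.generateFrom
    {U | ∃ (φ : Diff1c n) (K : Set (Eucl n)) (ε : ℝ), IsCompact K ∧ 0 < ε ∧ U = c1Ball φ K ε}

/-- `L` is the directional derivative `d/dt H(φ + tξ)` at `t = 0`. Part of the assertion is that
`φ + tξ` is in `Diff¹_c(ℝⁿ)` for all small `t`; `γ t` is that diffeomorphism. -/
def HasDirectionalDeriv {n : ℕ} (H : Diff1c n → ℝ) (φ : Diff1c n) (ξ : Eucl n → Eucl n)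
    (L : ℝ) : Prop :=
  ∃ γ : ℝ → Diff1c n, (∀ᶠ t in 𝓝 (0 : ℝ), ∀ x, γ t x = φ x + t • ξ x) ∧
    HasDerivAt (fun t => H (γ t)) L 0

/-- Gateaux differentiability of a function on `Diff¹_c(ℝⁿ)`: it is continuous and has a directional
derivative at every point in every direction. -/
def GateauxDifferentiable {n : ℕ} (H : Diff1c n → ℝ) : Prop :=
  Continuous H ∧ ∀ (φ : Diff1c n) (ξ : Eucl n → Eucl n), IsC1cField ξ →
    ∃ L : ℝ, HasDirectionalDeriv H φ ξ L

/-! ### The weighted integral -/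

/-- `d_{φ(S)}(φ(x))`. -/
def distImage {n : ℕ} (S : Set (Eucl n)) (φ : Diff1c n) (x : Eucl n) : ℝ :=
  Metric.infDist (φ x) (φ '' S)

/-- `s` is a point of `S` with `d_{φ(S)}(φ(x)) = |φ(x) - φ(s)|`. -/
def IsNearest {n : ℕ} (S : Set (Eucl n)) (φ : Diff1c n) (x s : Eucl n) : Prop :=
  s ∈ S ∧ distImage S φ x = ‖φ x - φ s‖

/-- `G(φ) = ∫_Ω u² ρ / (d_{φ(S)}² ∘ φ) dx`. -/
def weightedIntegral {n : ℕ} (Ω S : Set (Eucl n)) (u ρ : Eucl n → ℝ) (φ : Diff1c n) : ℝ :=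
  ∫ x in Ω, u x ^ 2 * ρ x / distImage S φ x ^ 2

/-- The integrand `u² ρ (φ(x) - φ(σ(x)))·(ξ(x) - ξ(σ(x))) / d_{φ(S)}(φ(x))⁴`. -/
def derivIntegrand {n : ℕ} (S : Set (Eucl n)) (u ρ : Eucl n → ℝ) (φ : Diff1c n)
    (σ ξ : Eucl n → Eucl n) (x : Eucl n) : ℝ :=
  u x ^ 2 * ρ x * inner ℝ (φ x - φ (σ x)) (ξ x - ξ (σ x)) / distImage S φ x ^ 4

end

end HardyShape

open HardyShape

namespace HardyShape

/-! ### Hardy's inequality -/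

/-! The set `S` lies outside `Ω` and every `φ` is bi-Lipschitz, so the distance from `φ x` to `φ ''
S` is at least a constant times the distance from `x` to `Ωᶜ`. Hardy's inequality on a Lipschitz
domain (`hardy`, extended to H¹₀ in `integrableOn_sq_div_infDist`) makes u²/d² integrable, hence
also the weighted integrand, since ρ is essentially bounded.

If ψ - φ has small Lipschitz constant, every |ψ(x) - ψ(s)| agrees with |φ(x) - φ(s)| up to a factor
near 1, and so do the infima over `S`. The integrands then differ by a small relative error
(`abs_integrand_sub_le`). This gives continuity, and for ψ = φ + tξ it bounds the difference
quotients by a multiple of the integrand at φ.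

The squared distance is a minimum over the compact set `S` of functions quadratic in t. Where the
minimizer is unique, its derivative is that of the minimizing branch (`hasDerivAt_min_of_unique`).
Rademacher's theorem gives uniqueness almost everywhere (`ae_isNearest_unique`), and dominated
convergence moves the derivative inside the integral. -/

theorem continuous_div_of_tsupport {X : Type*} [TopologicalSpace X] {k h : X → ℝ}
    (hk : Continuous k) (hh : Continuous h) (hne : ∀ x ∈ tsupport k, h x ≠ 0) :
    Continuous fun x => k x / h x := by
  rw [continuous_iff_continuousAt]
  intro x
  by_cases hx : x ∈ tsupport k
  · exact hk.continuousAt.div hh.continuousAt (hne x hx)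
  · have h0 : (fun y => k y / h y) =ᶠ[𝓝 x] fun _ => 0 := by
      filter_upwards [notMem_tsupport_iff_eventuallyEq.1 hx] with y hy
      simp [hy]
    exact (continuousAt_const (y := (0 : ℝ))).congr h0.symm

/-- Hardy's inequality with the weight `h⁻²`, where `h` has slope `1` in the direction `v`. -/
theorem integral_sq_div_le {E : Type*} [NormedAddCommGroup E] [NormedSpace ℝ E]
    [FiniteDimensional ℝ E] [MeasurableSpace E] [BorelSpace E] (μ : Measure E) [μ.IsAddHaarMeasure]
    {g h : E → ℝ} {v : E} (hg : ContDiff ℝ 1 g) (hgc : HasCompactSupport g)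
    (hh : Continuous h) (hv : ∀ x (t : ℝ), h (x + t • v) = h x + t)
    (hpos : ∀ x ∈ tsupport g, 0 < h x) :
    Integrable (fun x => (g x / h x) ^ 2) μ ∧ Integrable (fun x => (fderiv ℝ g x v) ^ 2) μ ∧
      ∫ x, (g x / h x) ^ 2 ∂μ ≤ 4 * ∫ x, (fderiv ℝ g x v) ^ 2 ∂μ := by
  have hq : Continuous fun x => g x / h x :=
    continuous_div_of_tsupport hg.continuous hh fun x hx => (hpos x hx).ne'
  have hqc : HasCompactSupport fun x => g x / h x := by
    simp only [div_eq_mul_inv]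
    exact hgc.mul_right
  have hd : Continuous fun x => fderiv ℝ g x v :=
    (hg.continuous_fderiv one_ne_zero).clm_apply continuous_const
  have hdc : HasCompactSupport fun x => fderiv ℝ g x v := hgc.fderiv_apply ℝ v
  have i1 : Integrable (fun x => (g x / h x) ^ 2) μ := by
    simp only [pow_two]
    exact (hq.mul hq).integrable_of_hasCompactSupport hqc.mul_right
  have i2 : Integrable (fun x => (fderiv ℝ g x v) ^ 2) μ := by
    simp only [pow_two]
    exact (hd.mul hd).integrable_of_hasCompactSupport hdc.mul_right
  have i3 : Integrable (fun x => 2 * (fderiv ℝ g x v * (g x / h x))) μ :=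
    ((hd.mul hq).integrable_of_hasCompactSupport hdc.mul_right).const_mul 2
  have i4 : Integrable (fun x => g x * (g x / h x)) μ :=
    (hg.continuous.mul hq).integrable_of_hasCompactSupport hgc.mul_right
  refine ⟨i1, i2, ?_⟩
  -- Since `h` has slope 1 along `v`, differentiating g²/h produces exactly the Hardy term -(g/h)².
  have hline : ∀ x, HasLineDerivAt ℝ (fun x => g x * (g x / h x))
      (2 * (fderiv ℝ g x v * (g x / h x)) - (g x / h x) ^ 2) x v := by
    intro x
    by_cases hx : x ∈ tsupport g
    · have h1 : HasDerivAt (fun t : ℝ => g (x + t • v)) (fderiv ℝ g x v) 0 :=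
        (hg.differentiable one_ne_zero x).hasFDerivAt.hasLineDerivAt v
      have h2 : HasDerivAt (fun t : ℝ => h (x + t • v)) 1 0 := by
        simp only [hv]
        exact (hasDerivAt_id (0 : ℝ)).const_add (h x)
      have hne : h (x + (0 : ℝ) • v) ≠ 0 := by simpa using (hpos x hx).ne'
      have h3 := h1.mul (h1.div h2 hne)
      have hne' := (hpos x hx).ne'
      refine HasDerivAt.congr_deriv h3 ?_
      simp only [Pi.div_apply, zero_smul, add_zero]
      field_simp
      ring
    · have h0 : (fun y => g y * (g y / h y)) =ᶠ[𝓝 x] fun _ => 0 := by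
        filter_upwards [notMem_tsupport_iff_eventuallyEq.1 hx] with y hy
        simp [hy]
      have hgx : g x = 0 := image_eq_zero_of_notMem_tsupport hx
      have := ((hasFDerivAt_const (𝕜 := ℝ) (0 : ℝ) x).congr_of_eventuallyEq h0).hasLineDerivAt v
      simpa [hgx] using this
  -- Pairing with the constant 1 says that the line derivative of g²/h has integral zero.
  have key := integral_bilinear_hasLineDerivAt_right_eq_neg_left_of_integrable (μ := μ)
    (f := fun _ : E => (1 : ℝ)) (f' := fun _ => 0) (g := fun x => g x * (g x / h x))
    (g' := fun x => 2 * (fderiv ℝ g x v * (g x / h x)) - (g x / h x) ^ 2) (v := v)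
    (B := ContinuousLinearMap.mul ℝ ℝ) (by simp) (by simp only [ContinuousLinearMap.mul_apply', one_mul]; exact i3.sub i1) (by simpa using i4)
    (fun x _ => (hasFDerivAt_const (𝕜 := ℝ) (1 : ℝ) x).hasLineDerivAt v) (fun x _ => hline x)
  simp only [ContinuousLinearMap.mul_apply', one_mul, zero_mul, integral_zero, neg_zero] at key
  rw [integral_sub i3 i1, sub_eq_zero] at key
  -- Young's inequality 2ab ≤ 2a² + b²/2; the last term is absorbed on the left, leaving the
  -- constant 4.
  have hle : ∫ x, 2 * (fderiv ℝ g x v * (g x / h x)) ∂μ ≤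
      ∫ x, 2 * (fderiv ℝ g x v) ^ 2 + 2⁻¹ * (g x / h x) ^ 2 ∂μ := by
    refine integral_mono i3 ((i2.const_mul 2).add (i1.const_mul _)) fun x => ?_
    simp only
    nlinarith [sq_nonneg (2 * fderiv ℝ g x v - g x / h x)]
  rw [key, integral_add (i2.const_mul 2) (i1.const_mul _), integral_const_mul,
    integral_const_mul] at hle
  linarith

/-- The same in terms of lower Lebesgue integrals. -/
theorem lintegral_sq_div_le {E : Type*} [NormedAddCommGroup E] [NormedSpace ℝ E]
    [FiniteDimensional ℝ E] [MeasurableSpace E] [BorelSpace E] (μ : Measure E) [μ.IsAddHaarMeasure]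
    {g h : E → ℝ} {v : E} (hg : ContDiff ℝ 1 g) (hgc : HasCompactSupport g)
    (hh : Continuous h) (hv : ∀ x (t : ℝ), h (x + t • v) = h x + t)
    (hpos : ∀ x ∈ tsupport g, 0 < h x) :
    ∫⁻ x, ENNReal.ofReal ((g x / h x) ^ 2) ∂μ ≤
      ENNReal.ofReal 4 * ∫⁻ x, ENNReal.ofReal ((fderiv ℝ g x v) ^ 2) ∂μ := by
  obtain ⟨i1, i2, hle⟩ := integral_sq_div_le μ hg hgc hh hv hpos
  rw [← ofReal_integral_eq_lintegral_ofReal i1 (ae_of_all _ fun x => sq_nonneg _),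
    ← ofReal_integral_eq_lintegral_ofReal i2 (ae_of_all _ fun x => sq_nonneg _),
    ← ENNReal.ofReal_mul (by norm_num)]
  exact ENNReal.ofReal_le_ofReal hle

/-- The squared `H¹` norm of a test function on `Ω`. -/
noncomputable def energy {n : ℕ} (Ω : Set (Eucl n)) (ψ : Eucl n → ℝ) : ℝ≥0∞ :=
  ∫⁻ x in Ω, ENNReal.ofReal (ψ x ^ 2 + ‖gradient ψ x‖ ^ 2)

theorem norm_gradient {n : ℕ} (ψ : Eucl n → ℝ) (x : Eucl n) : ‖gradient ψ x‖ = ‖fderiv ℝ ψ x‖ := by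
  simp [gradient]

/-- The height above the boundary graph is comparable to the distance to the complement. -/
theorem exists_height {n : ℕ} {Ω : Set (Eucl n)} (hΩ : IsBoundedLipschitzDomain Ω) {p : Eucl n}
    (hp : p ∈ frontier Ω) :
    ∃ (h : Eucl n → ℝ) (v : Eucl n) (C r : ℝ), ‖v‖ = 1 ∧ Continuous h ∧ 0 < C ∧ 0 < r ∧
      (∀ x (t : ℝ), h (x + t • v) = h x + t) ∧ (∀ x ∈ Metric.ball p r, x ∈ Ω → 0 < h x) ∧
      ∀ x ∈ Metric.ball p (r / 2), h x ≤ C * Metric.infDist x Ωᶜ := by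
  obtain ⟨v, hv, f, K, hf, r, hr, hgraph⟩ := hΩ.lipschitz_boundary p hp
  have hpΩ : p ∉ Ω := fun h => by
    rw [hΩ.isOpen.frontier_eq] at hp
    exact hp.2 h
  have hproj : Continuous fun x : Eucl n => x - inner ℝ v x • v := by fun_prop
  -- The height above the graph: moving along `v` leaves the horizontal projection fixed.
  set h : Eucl n → ℝ := fun x => inner ℝ v x - f (x - inner ℝ v x • v) with hh
  have hinner : ∀ w : Eucl n, |inner ℝ v w| ≤ ‖w‖ := fun w => by
    simpa [hv] using abs_real_inner_le_norm v w
  have hlip : ∀ x q, q ∉ Ω → q ∈ Metric.ball p r → h x ≤ (1 + K * 2) * dist x q := by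
    intro x q hq hqb
    have h1 : h q ≤ 0 := by
      have := mt (hgraph q hqb).2 hq
      simp only [hh]; linarith
    have h2 : |f (x - inner ℝ v x • v) - f (q - inner ℝ v q • v)| ≤ K * (2 * dist x q) := by
      rw [← Real.dist_eq]
      refine (hf.dist_le_mul _ _).trans (mul_le_mul_of_nonneg_left ?_ K.2)
      rw [dist_eq_norm, show x - inner ℝ v x • v - (q - inner ℝ v q • v)
        = (x - q) - inner ℝ v (x - q) • v by rw [inner_sub_right, sub_smul]; abel]
      refine (norm_sub_le _ _).trans ?_
      rw [norm_smul, hv, mul_one, dist_eq_norm, two_mul]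
      gcongr
      exact hinner _
    have h3 : inner ℝ v x - inner ℝ v q ≤ dist x q := by
      rw [← inner_sub_right, dist_eq_norm]
      exact (le_abs_self _).trans (hinner _)
    have h4 := abs_le.1 h2
    simp only [hh] at h1 ⊢
    linarith [h4.1]
  refine ⟨h, v, 1 + K * 2, r, hv, ?_, by positivity, hr, ?_, ?_, ?_⟩
  · exact (by fun_prop : Continuous fun x : Eucl n => inner ℝ v x).sub (hf.continuous.comp hproj)
  · intro x t
    have h1 : inner ℝ v (x + t • v) = inner ℝ v x + t := by
      rw [inner_add_right, inner_smul_right, real_inner_self_eq_norm_sq, hv]; ring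
    simp only [hh, h1, add_smul, add_sub_add_right_eq_sub]
    ring
  · intro x hx hxΩ
    have := (hgraph x hx).1 hxΩ
    simp only [hh]; linarith
  · intro x hx
    have hC : (0 : ℝ) < 1 + K * 2 := by positivity
    rw [← div_le_iff₀' hC, Metric.le_infDist ⟨p, hpΩ⟩]
    intro q hq
    rw [div_le_iff₀' hC]
    by_cases hqb : q ∈ Metric.ball p r
    · exact hlip x q hq hqb
    -- A point `q` outside the large ball is farther from `x` than `p` is, and `p` itself lies off
    -- `Ω`.
    · refine (hlip x p hpΩ (Metric.mem_ball_self hr)).trans ?_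
      gcongr
      rw [Metric.mem_ball] at hx hqb
      have := dist_triangle_left q p x
      linarith

/-- Hardy's inequality near a boundary point. -/
theorem local_hardy_frontier {n : ℕ} {Ω : Set (Eucl n)} (hΩ : IsBoundedLipschitzDomain Ω)
    {p : Eucl n} (hp : p ∈ frontier Ω) :
    ∃ U ∈ 𝓝 p, ∃ C : ℝ, ∀ ψ, IsTestFunction Ω ψ →
      ∫⁻ x in U ∩ Ω, ENNReal.ofReal ((ψ x / Metric.infDist x Ωᶜ) ^ 2) ≤
        ENNReal.ofReal C * energy Ω ψ := by
  obtain ⟨h, v, C, r, hv, hh, hC, hr, hvt, hpos, hcomp⟩ := exists_height hΩ hp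
  let χ : ContDiffBump p := ⟨r / 4, r / 2, by linarith, by linarith⟩
  have hχ1 : ContDiff ℝ 1 χ := χ.contDiff
  obtain ⟨M, hM⟩ := χ.hasCompactSupport.fderiv ℝ |>.exists_bound_of_continuous
    (hχ1.continuous_fderiv one_ne_zero)
  refine ⟨Metric.ball p (r / 4), Metric.ball_mem_nhds _ (by linarith),
    C ^ 2 * (4 * (2 + 2 * M ^ 2)), fun ψ hψ => ?_⟩
  have hψ1 : ContDiff ℝ 1 ψ := hψ.smooth.of_le (by exact_mod_cast le_top)
  have hg : ContDiff ℝ 1 fun x => χ x * ψ x := hχ1.mul hψ1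
  have hgc : HasCompactSupport fun x => χ x * ψ x := hψ.hasCompactSupport.mul_left
  have hgpos : ∀ x ∈ tsupport (fun x => χ x * ψ x), 0 < h x := by
    intro x hx
    have h1 := tsupport_mul_subset_left hx
    have h2 := tsupport_mul_subset_right hx
    rw [χ.tsupport_eq] at h1
    exact hpos x (Metric.closedBall_subset_ball (show r / 2 < r by linarith) h1)
      (hψ.tsupport_subset h2)
  have H := lintegral_sq_div_le (volume : Measure (Eucl n)) hg hgc hh hvt hgpos
  -- Product rule with (a + b)² ≤ 2a² + 2b², 0 ≤ χ ≤ 1 and |∂χ| ≤ M.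
  have hder : ∀ x, (fderiv ℝ (fun x => χ x * ψ x) x v) ^ 2 ≤
      Ω.indicator (fun x => (2 + 2 * M ^ 2) * (ψ x ^ 2 + ‖gradient ψ x‖ ^ 2)) x := by
    intro x
    by_cases hx : x ∈ Ω
    · rw [Set.indicator_of_mem hx, norm_gradient]
      rw [fderiv_fun_mul (hχ1.differentiable one_ne_zero x) (hψ1.differentiable one_ne_zero x)]
      simp only [add_apply, smul_apply, smul_eq_mul]
      have a1 : |fderiv ℝ ψ x v| ≤ ‖fderiv ℝ ψ x‖ := by
        simpa [hv] using (fderiv ℝ ψ x).le_opNorm v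
      have a2 : |fderiv ℝ χ x v| ≤ M := by
        have := (fderiv ℝ χ x).le_opNorm v
        rw [hv, mul_one] at this
        exact this.trans (hM x)
      have b1 : (χ x * fderiv ℝ ψ x v) ^ 2 ≤ ‖fderiv ℝ ψ x‖ ^ 2 := by
        rw [mul_pow, ← sq_abs (fderiv ℝ ψ x v)]
        have c1 : (χ x) ^ 2 ≤ 1 := pow_le_one₀ χ.nonneg χ.le_one
        have c2 : |fderiv ℝ ψ x v| ^ 2 ≤ ‖fderiv ℝ ψ x‖ ^ 2 := by gcongr
        nlinarith [sq_nonneg (|fderiv ℝ ψ x v|)]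
      have b2 : (ψ x * fderiv ℝ χ x v) ^ 2 ≤ M ^ 2 * ψ x ^ 2 := by
        rw [mul_pow, ← sq_abs (fderiv ℝ χ x v), mul_comm]
        gcongr
      have := sq_nonneg (χ x * fderiv ℝ ψ x v - ψ x * fderiv ℝ χ x v)
      have := mul_nonneg (sq_nonneg M) (sq_nonneg ‖fderiv ℝ ψ x‖)
      nlinarith [sq_nonneg (ψ x)]
    · rw [Set.indicator_of_notMem hx]
      have hx' : x ∉ tsupport (fun x => χ x * ψ x) := fun h =>
        hx (hψ.tsupport_subset (tsupport_mul_subset_right h))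
      have : fderiv ℝ (fun x => χ x * ψ x) x = 0 :=
        image_eq_zero_of_notMem_tsupport fun h => hx' (tsupport_fderiv_subset ℝ h)
      simp [this]
  have hR : ∫⁻ x, ENNReal.ofReal ((fderiv ℝ (fun x => χ x * ψ x) x v) ^ 2) ≤
      ENNReal.ofReal (2 + 2 * M ^ 2) * energy Ω ψ := by
    rw [energy, ← lintegral_const_mul' _ _ ENNReal.ofReal_ne_top,
      ← lintegral_indicator hΩ.isOpen.measurableSet]
    refine lintegral_mono fun x => ?_
    refine (ENNReal.ofReal_le_ofReal (hder x)).trans (le_of_eq ?_)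
    by_cases hx : x ∈ Ω
    · simp only [Set.indicator_of_mem hx]
      rw [ENNReal.ofReal_mul (by positivity)]
    · simp [Set.indicator_of_notMem hx]
  have hL : ∫⁻ x in Metric.ball p (r / 4) ∩ Ω,
        ENNReal.ofReal ((ψ x / Metric.infDist x Ωᶜ) ^ 2) ≤
      ENNReal.ofReal (C ^ 2) * ∫⁻ x, ENNReal.ofReal ((χ x * ψ x / h x) ^ 2) := by
    rw [← lintegral_const_mul' _ _ ENNReal.ofReal_ne_top]
    refine le_trans ?_ (setLIntegral_le_lintegral (Metric.ball p (r / 4) ∩ Ω) _)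
    refine setLIntegral_mono' (Metric.isOpen_ball.inter hΩ.isOpen).measurableSet fun x hx => ?_
    rw [← ENNReal.ofReal_mul (by positivity)]
    refine ENNReal.ofReal_le_ofReal ?_
    have hχx : χ x = 1 := χ.one_of_mem_closedBall (Metric.ball_subset_closedBall hx.1)
    have hx0 : 0 < h x := hpos x (Metric.ball_subset_ball (by linarith) hx.1) hx.2
    have hxd := hcomp x (Metric.ball_subset_ball (by linarith) hx.1)
    rw [hχx, one_mul, div_pow, div_pow, mul_div_assoc']
    have hd : 0 < Metric.infDist x Ωᶜ := by
      by_contra hd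
      nlinarith [Metric.infDist_nonneg (x := x) (s := Ωᶜ)]
    rw [div_le_div_iff₀ (by positivity) (by positivity)]
    have : h x ^ 2 ≤ C ^ 2 * Metric.infDist x Ωᶜ ^ 2 := by
      rw [← mul_pow]; gcongr
    nlinarith [sq_nonneg (ψ x)]
  refine hL.trans ?_
  rw [ENNReal.ofReal_mul (by positivity), ENNReal.ofReal_mul (by norm_num), mul_assoc, mul_assoc]
  gcongr
  exact H.trans (by gcongr)

/-- Hardy's inequality near an interior point. -/
theorem local_hardy_interior {n : ℕ} {Ω : Set (Eucl n)} (hΩ : IsOpen Ω) (hne : Ωᶜ.Nonempty)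
    {p : Eucl n} (hp : p ∈ Ω) :
    ∃ U ∈ 𝓝 p, ∃ C : ℝ, ∀ ψ, IsTestFunction Ω ψ →
      ∫⁻ x in U ∩ Ω, ENNReal.ofReal ((ψ x / Metric.infDist x Ωᶜ) ^ 2) ≤
        ENNReal.ofReal C * energy Ω ψ := by
  have hd : 0 < Metric.infDist p Ωᶜ :=
    (hΩ.isClosed_compl.notMem_iff_infDist_pos hne).1 (fun h => h hp)
  set d := Metric.infDist p Ωᶜ
  refine ⟨{x | d / 2 < Metric.infDist x Ωᶜ},
    (isOpen_lt continuous_const (Metric.continuous_infDist_pt _)).mem_nhds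
      (by simp only [Set.mem_ofPred_eq]; linarith), ((d / 2) ^ 2)⁻¹, fun ψ _ => ?_⟩
  rw [energy, ← lintegral_const_mul' _ _ ENNReal.ofReal_ne_top]
  refine le_trans ?_ (lintegral_mono_set (Set.inter_subset_right
    (s := {x | d / 2 < Metric.infDist x Ωᶜ})))
  refine setLIntegral_mono' ((isOpen_lt continuous_const
    (Metric.continuous_infDist_pt _)).inter hΩ).measurableSet fun x hx => ?_
  rw [← ENNReal.ofReal_mul (by positivity)]
  refine ENNReal.ofReal_le_ofReal ?_
  have hx1 : d / 2 < Metric.infDist x Ωᶜ := hx.1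
  rw [div_pow, div_eq_inv_mul]
  gcongr
  nlinarith [sq_nonneg ‖gradient ψ x‖]

/-- The local estimates pass to subsets and finite unions, so compactness of `closure Ω` makes them
global. -/
theorem hardy {n : ℕ} {Ω : Set (Eucl n)} (hΩ : IsBoundedLipschitzDomain Ω) (hne : Ωᶜ.Nonempty) :
    ∃ C : ℝ, ∀ ψ, IsTestFunction Ω ψ →
      ∫⁻ x in Ω, ENNReal.ofReal ((ψ x / Metric.infDist x Ωᶜ) ^ 2) ≤
        ENNReal.ofReal C * energy Ω ψ := by
  have hcpt : IsCompact (closure Ω) := hΩ.isBounded.isCompact_closure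
  have := hcpt.induction_on (p := fun U => ∃ C : ℝ, ∀ ψ, IsTestFunction Ω ψ →
      ∫⁻ x in U ∩ Ω, ENNReal.ofReal ((ψ x / Metric.infDist x Ωᶜ) ^ 2) ≤
        ENNReal.ofReal C * energy Ω ψ) ⟨0, by simp⟩ ?_ ?_ ?_
  · rwa [Set.inter_eq_right.2 subset_closure] at this
  · rintro s t hst ⟨C, hC⟩
    exact ⟨C, fun ψ hψ =>
      (lintegral_mono_set (Set.inter_subset_inter_left Ω hst)).trans (hC ψ hψ)⟩
  · rintro s t ⟨C, hC⟩ ⟨D, hD⟩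
    refine ⟨max C 0 + max D 0, fun ψ hψ => ?_⟩
    rw [Set.union_inter_distrib_right, ENNReal.ofReal_add (le_max_right _ _) (le_max_right _ _),
      add_mul]
    refine (lintegral_union_le _ _ _).trans (add_le_add ((hC ψ hψ).trans ?_) ((hD ψ hψ).trans ?_))
      <;> gcongr <;> exact le_max_left _ _
  · intro p hp
    obtain ⟨U, hU, h⟩ : ∃ U ∈ 𝓝 p, ∃ C : ℝ, ∀ ψ, IsTestFunction Ω ψ →
        ∫⁻ x in U ∩ Ω, ENNReal.ofReal ((ψ x / Metric.infDist x Ωᶜ) ^ 2) ≤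
          ENNReal.ofReal C * energy Ω ψ := by
      by_cases hpΩ : p ∈ Ω
      · exact local_hardy_interior hΩ.isOpen hne hpΩ
      · refine local_hardy_frontier hΩ ?_
        rw [hΩ.isOpen.frontier_eq]
        exact ⟨hp, hpΩ⟩
    exact ⟨U, mem_nhdsWithin_of_mem_nhds hU, h⟩

theorem lintegral_ofReal_norm_sq {α F : Type*} [MeasurableSpace α] [NormedAddCommGroup F]
    (μ : Measure α) (f : α → F) :
    ∫⁻ x, ENNReal.ofReal (‖f x‖ ^ 2) ∂μ = eLpNorm f 2 μ ^ 2 := by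
  have h := eLpNorm_nnreal_pow_eq_lintegral (μ := μ) (f := f) (p := 2) two_ne_zero
  simp only [NNReal.coe_ofNat, ENNReal.coe_ofNat, ENNReal.rpow_ofNat] at h
  rw [h]
  refine lintegral_congr fun x => ?_
  rw [ENNReal.ofReal_pow (norm_nonneg _), ofReal_norm]

theorem energy_eq {n : ℕ} (Ω : Set (Eucl n)) {ψ : Eucl n → ℝ} (hψ : IsTestFunction Ω ψ) :
    energy Ω ψ = eLpNorm ψ 2 (volume.restrict Ω) ^ 2 +
      eLpNorm (gradient ψ) 2 (volume.restrict Ω) ^ 2 := by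
  rw [← lintegral_ofReal_norm_sq, ← lintegral_ofReal_norm_sq, energy, ← lintegral_add_left]
  · refine lintegral_congr fun x => ?_
    rw [ENNReal.ofReal_add (by positivity) (by positivity), Real.norm_eq_abs, sq_abs]
  · exact ((hψ.smooth.continuous.norm.pow 2).measurable).ennreal_ofReal

theorem continuous_gradient {n : ℕ} {Ω : Set (Eucl n)} {ψ : Eucl n → ℝ} (hψ : IsTestFunction Ω ψ) :
    Continuous (gradient ψ) :=
  (LinearIsometryEquiv.continuous _).comp (hψ.smooth.continuous_fderiv (by simp))

/-- Hardy's inequality for `H¹₀(Ω)`, in qualitative form. -/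
theorem integrableOn_sq_div_infDist {n : ℕ} {Ω : Set (Eucl n)} (hΩ : IsBoundedLipschitzDomain Ω)
    (hne : Ωᶜ.Nonempty) {u : Eucl n → ℝ} (hu : MemH10 Ω u) :
    IntegrableOn (fun x => (u x / Metric.infDist x Ωᶜ) ^ 2) Ω := by
  obtain ⟨hu2, g, hg2, -, hlim⟩ := hu
  obtain ⟨C, hC⟩ := hardy hΩ hne
  set μ := volume.restrict Ω
  have hεpos : ∀ k : ℕ, 0 < ((k : ℝ≥0∞) + 1)⁻¹ := fun k => by simp
  choose ψ hψ hψu hψg using fun k : ℕ => hlim _ (hεpos k)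
  have hψm : ∀ k, AEStronglyMeasurable (ψ k) μ := fun k =>
    (hψ k).smooth.continuous.aestronglyMeasurable
  have hgm : ∀ k, AEStronglyMeasurable (gradient (ψ k)) μ := fun k =>
    (continuous_gradient (hψ k)).aestronglyMeasurable
  have hε1 : ∀ k : ℕ, ((k : ℝ≥0∞) + 1)⁻¹ ≤ 1 := fun k => by simp
  have hbd : ∀ k, energy Ω (ψ k) ≤ (1 + eLpNorm u 2 μ) ^ 2 + (1 + eLpNorm g 2 μ) ^ 2 := by
    intro k
    rw [energy_eq Ω (hψ k)]
    gcongr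
    · calc eLpNorm (ψ k) 2 μ = eLpNorm ((ψ k - u) + u) 2 μ := by simp
        _ ≤ eLpNorm (ψ k - u) 2 μ + eLpNorm u 2 μ :=
            eLpNorm_add_le ((hψm k).sub hu2.1) hu2.1 (by norm_num)
        _ ≤ 1 + eLpNorm u 2 μ := by
            gcongr
            rw [eLpNorm_sub_comm]
            exact (hψu k).le.trans (hε1 k)
    · calc eLpNorm (gradient (ψ k)) 2 μ = eLpNorm ((gradient (ψ k) - g) + g) 2 μ := by simp
        _ ≤ eLpNorm (gradient (ψ k) - g) 2 μ + eLpNorm g 2 μ :=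
            eLpNorm_add_le ((hgm k).sub hg2.1) hg2.1 (by norm_num)
        _ ≤ 1 + eLpNorm g 2 μ := by
            gcongr
            rw [eLpNorm_sub_comm]
            exact (hψg k).le.trans (hε1 k)
  have htend : Tendsto (fun k => eLpNorm (ψ k - u) 2 μ) atTop (𝓝 0) := by
    refine tendsto_of_tendsto_of_tendsto_of_le_of_le tendsto_const_nhds
      ?_ (fun k => zero_le) (fun k => ?_) (h := fun k : ℕ => ((k : ℝ≥0∞))⁻¹)
    · exact ENNReal.tendsto_inv_nat_nhds_zero
    · simp only
      rw [eLpNorm_sub_comm]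
      exact (hψu k).le.trans (ENNReal.inv_le_inv.2 le_self_add)
  obtain ⟨ns, -, hns⟩ := (tendstoInMeasure_of_tendsto_eLpNorm two_ne_zero hψm hu2.1
    htend).exists_seq_tendsto_ae
  have hdm : Measurable fun x : Eucl n => Metric.infDist x Ωᶜ :=
    (Metric.continuous_infDist_pt _).measurable
  refine ⟨((hu2.1.aemeasurable.div hdm.aemeasurable).pow_const 2).aestronglyMeasurable, ?_⟩
  rw [hasFiniteIntegral_iff_ofReal (ae_of_all _ fun x => sq_nonneg _)]
  -- Fatou's lemma along a subsequence of test functions converging almost everywhere, with energies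
  -- bounded uniformly by `hbd`.
  calc ∫⁻ x, ENNReal.ofReal ((u x / Metric.infDist x Ωᶜ) ^ 2) ∂μ
      = ∫⁻ x, liminf (fun k => ENNReal.ofReal ((ψ (ns k) x / Metric.infDist x Ωᶜ) ^ 2)) atTop ∂μ := by
        refine lintegral_congr_ae ?_
        filter_upwards [hns] with x hx
        exact (ENNReal.tendsto_ofReal ((hx.div_const _).pow 2)).liminf_eq.symm
    _ ≤ liminf (fun k => ∫⁻ x, ENNReal.ofReal ((ψ (ns k) x / Metric.infDist x Ωᶜ) ^ 2) ∂μ) atTop :=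
        lintegral_liminf_le fun k =>
          (((hψ (ns k)).smooth.continuous.measurable.div hdm).pow_const 2).ennreal_ofReal
    _ ≤ ENNReal.ofReal C * ((1 + eLpNorm u 2 μ) ^ 2 + (1 + eLpNorm g 2 μ) ^ 2) := by
        refine liminf_le_of_le (by isBoundedDefault) fun b hb => ?_
        obtain ⟨k, hk⟩ := hb.exists
        exact hk.trans ((hC _ (hψ _)).trans (by gcongr; exact hbd _))
    _ < ⊤ := by
        refine ENNReal.mul_lt_top ENNReal.ofReal_lt_top (ENNReal.add_lt_top.2 ⟨?_, ?_⟩)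
        · exact ENNReal.pow_lt_top (ENNReal.add_lt_top.2 ⟨ENNReal.one_lt_top, hu2.2⟩)
        · exact ENNReal.pow_lt_top (ENNReal.add_lt_top.2 ⟨ENNReal.one_lt_top, hg2.2⟩)

/-! ### Compactly supported diffeomorphisms -/

theorem exists_lipschitzWith_of_isCompact_closure {E : Type*} [NormedAddCommGroup E]
    [NormedSpace ℝ E] {f : E → E} (hf : ContDiff ℝ 1 f) (hc : IsCompact (closure {x | f x ≠ x})) :
    ∃ L, LipschitzWith L f := by
  have hsupp : HasCompactSupport fun x => f x - x := by
    have : Function.support (fun x => f x - x) = {x | f x ≠ x} := by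
      ext x; simp [sub_eq_zero]
    rwa [HasCompactSupport, tsupport, this]
  obtain ⟨L, hL⟩ := (hf.sub contDiff_id).lipschitzWith_of_hasCompactSupport hsupp one_ne_zero
  exact ⟨L + 1, by simpa using hL.add LipschitzWith.id⟩

theorem Diff1c.exists_lipschitzWith {n : ℕ} (φ : Diff1c n) : ∃ L, LipschitzWith L φ :=
  exists_lipschitzWith_of_isCompact_closure φ.contDiff φ.isCompact_support

/-- The inverse moves the same points as `φ`, so it is Lipschitz too. -/
theorem Diff1c.exists_mul_norm_sub_le {n : ℕ} (φ : Diff1c n) :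
    ∃ c : ℝ, 0 < c ∧ ∀ x y, c * ‖x - y‖ ≤ ‖φ x - φ y‖ := by
  obtain ⟨L, hL⟩ := exists_lipschitzWith_of_isCompact_closure φ.contDiff_symm (by
    have : {x | φ.toHomeomorph.symm x ≠ x} = {x | φ.toHomeomorph x ≠ x} := by
      ext x
      exact not_congr ((φ.toHomeomorph.symm_apply_eq).trans eq_comm)
    rw [this]
    exact φ.isCompact_support)
  -- The added 1 keeps the constant meaningful when `L` is 0.
  refine ⟨((L : ℝ) + 1)⁻¹, by positivity, fun x y => ?_⟩
  have h := hL.norm_sub_le (φ x) (φ y)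
  simp only [Homeomorph.symm_apply_apply] at h
  rw [inv_mul_le_iff₀ (by positivity)]
  nlinarith [norm_nonneg (φ x - φ y)]

theorem norm_le_sum_norm_single {n : ℕ} {F : Type*} [NormedAddCommGroup F] [NormedSpace ℝ F]
    (A : Eucl n →L[ℝ] F) : ‖A‖ ≤ ∑ i, ‖A (EuclideanSpace.single i 1)‖ := by
  refine A.opNorm_le_bound (Finset.sum_nonneg fun i _ => norm_nonneg _) fun v => ?_
  have hv : v = ∑ i, v i • EuclideanSpace.single i (1 : ℝ) := by
    simpa using ((EuclideanSpace.basisFun (Fin n) ℝ).sum_repr v).symm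
  calc ‖A v‖ = ‖∑ i, v i • A (EuclideanSpace.single i 1)‖ := by
        conv_lhs => rw [hv]
        simp only [map_sum, map_smul]
    _ ≤ ∑ i, ‖A (EuclideanSpace.single i 1)‖ * ‖v‖ := by
        refine norm_sum_le_of_le _ fun i _ => ?_
        rw [norm_smul, mul_comm]
        gcongr
        exact PiLp.norm_apply_le v i
    _ = _ := by rw [Finset.sum_mul]

theorem norm_fderiv_le_c1Norm {n : ℕ} {K : Set (Eucl n)} (hK : IsCompact K) {f : Eucl n → Eucl n}
    (hf : ContDiff ℝ 1 f) {x : Eucl n} (hx : x ∈ K) : ‖fderiv ℝ f x‖ ≤ c1Norm K f := by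
  refine (norm_le_sum_norm_single _).trans ?_
  refine le_trans (Finset.sum_le_sum fun i _ => ?_)
    (le_add_of_nonneg_left (Real.iSup_nonneg fun x : K => norm_nonneg (f x)))
  have hcont : Continuous fun y => ‖partialDeriv i f y‖ :=
    ((hf.continuous_fderiv one_ne_zero).clm_apply continuous_const).norm
  have hb : BddAbove (Set.range fun y : K => ‖partialDeriv i f y‖) := by
    have := hK.bddAbove_image hcont.continuousOn
    rwa [Set.image_eq_range] at this
  exact le_ciSup hb (⟨x, hx⟩ : K)

theorem c1Ball_mem_nhds {n : ℕ} (φ : Diff1c n) {K : Set (Eucl n)} (hK : IsCompact K) {ε : ℝ}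
    (hε : 0 < ε) : c1Ball φ K ε ∈ 𝓝 φ := by
  refine IsOpen.mem_nhds (TopologicalSpace.isOpen_generateFrom_of_mem ⟨φ, K, ε, hK, hε, rfl⟩) ?_
  have : ∀ i, partialDeriv i (fun _ : Eucl n => (0 : Eucl n)) = fun _ => 0 := fun i => by
    ext1 x
    simp [partialDeriv]
  simp [c1Ball, c1Norm, this, hε]

/-- Maps `C¹`-close to `φ` differ from it by a map with small Lipschitz constant. -/
theorem eventually_norm_sub_le {n : ℕ} (φ : Diff1c n) {B : Set (Eucl n)}
    (hB : Bornology.IsBounded B) {ε : ℝ} (hε : 0 < ε) :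
    ∀ᶠ ψ : Diff1c n in 𝓝 φ, ∀ x ∈ B, ∀ y ∈ B, ‖(ψ x - φ x) - (ψ y - φ y)‖ ≤ ε * ‖x - y‖ := by
  obtain ⟨R, hR⟩ := hB.subset_closedBall 0
  filter_upwards [c1Ball_mem_nhds φ (isCompact_closedBall (0 : Eucl n) R) hε] with ψ hψ x hx y hy
  have hd : ContDiff ℝ 1 fun x => ψ x - φ x := ψ.contDiff.sub φ.contDiff
  -- The mean value inequality needs a convex set, hence the ball containing `B`.
  exact Convex.norm_image_sub_le_of_norm_fderiv_le (𝕜 := ℝ) (f := fun x => ψ x - φ x)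
    (fun z _ => hd.differentiable one_ne_zero z)
    (fun z hz => (norm_fderiv_le_c1Norm (isCompact_closedBall _ _) hd hz).trans (le_of_lt hψ))
    (convex_closedBall _ _) (hR hy) (hR hx)

/-- A perturbation of the identity by a contraction is a homeomorphism. Its derivative id + Dη is
invertible by the Neumann series, so the inverse is C¹. -/
theorem exists_homeomorph_add {E : Type*} [NormedAddCommGroup E] [NormedSpace ℝ E] [CompleteSpace E]
    {η : E → E} {K : NNReal} (hη : ContDiff ℝ 1 η) (hK : LipschitzWith K η) (hK1 : K < 1) :
    ∃ H : E ≃ₜ E, (∀ x, H x = x + η x) ∧ ContDiff ℝ 1 H.symm := by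
  have happ : ApproximatesLinearOn (fun x => x + η x)
      ((ContinuousLinearEquiv.refl ℝ E : E ≃L[ℝ] E) : E →L[ℝ] E) Set.univ K := by
    intro x _ y _
    simpa [add_sub_add_comm] using hK.norm_sub_le x y
  have hc : Subsingleton E ∨ K < ‖((ContinuousLinearEquiv.refl ℝ E).symm : E →L[ℝ] E)‖₊⁻¹ := by
    rcases subsingleton_or_nontrivial E with h | h
    · exact Or.inl h
    · right
      simpa using hK1
  let H : E ≃ₜ E := happ.toHomeomorph _ hc
  have hH : ∀ x, H x = x + η x := fun x => rfl
  have hnorm : ∀ a, ‖-fderiv ℝ η a‖ < 1 := fun a => by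
    rw [norm_neg]
    exact lt_of_le_of_lt (norm_fderiv_le_of_lipschitz ℝ hK) (by exact_mod_cast hK1)
  refine ⟨H, hH, H.contDiff_symm
    (f₀' := fun a => ContinuousLinearEquiv.unitsEquiv ℝ E (Units.oneSub _ (hnorm a))) (fun a => ?_)
    (contDiff_id.add hη)⟩
  have h1 : HasFDerivAt (fun x => x + η x) (ContinuousLinearMap.id ℝ E + fderiv ℝ η a) a :=
    (hasFDerivAt_id a).add (hη.differentiable one_ne_zero a).hasFDerivAt
  refine h1.congr_fderiv ?_
  ext v
  simp

/-- `φ + tξ` is a diffeomorphism for small `t`. -/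
theorem Diff1c.exists_add_smul {n : ℕ} (φ : Diff1c n) {ξ : Eucl n → Eucl n} (hξ : IsC1cField ξ) :
    ∃ γ : ℝ → Diff1c n, ∀ᶠ t in 𝓝 (0 : ℝ), ∀ x, γ t x = φ x + t • ξ x := by
  -- Factor φ + tξ as (id + t ξ∘φ⁻¹)∘φ, reducing the claim to a perturbation of the identity.
  have hη : ContDiff ℝ 1 fun y => ξ (φ.toHomeomorph.symm y) := hξ.contDiff.comp φ.contDiff_symm
  obtain ⟨L, hL⟩ := hη.lipschitzWith_of_hasCompactSupport
    (hξ.hasCompactSupport.comp_homeomorph φ.toHomeomorph.symm) one_ne_zero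
  have key : ∀ t : ℝ, ‖t‖₊ * L < 1 → ∃ ψ : Diff1c n, ∀ x, ψ x = φ x + t • ξ x := by
    intro t ht
    obtain ⟨H, hH, hHs⟩ := exists_homeomorph_add (hη.const_smul t) ((lipschitzWith_smul t).comp hL) ht
    have hval : ∀ x, (φ.toHomeomorph.trans H) x = φ x + t • ξ x := fun x => by simp [hH]
    have hsymm : ⇑(φ.toHomeomorph.trans H).symm = ⇑φ.toHomeomorph.symm ∘ ⇑H.symm := by
      ext1 x
      simp
    refine ⟨⟨φ.toHomeomorph.trans H, ?_, by rw [hsymm]; exact φ.contDiff_symm.comp hHs, ?_⟩, hval⟩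
    · simp only [funext hval]
      exact φ.contDiff.add (hξ.contDiff.const_smul t)
    · refine (φ.isCompact_support.union hξ.hasCompactSupport).of_isClosed_subset isClosed_closure
        (closure_minimal ?_ (isClosed_closure.union isClosed_closure))
      intro x hx
      by_contra hx'
      rw [Set.mem_union, not_or] at hx'
      have h1 : φ x = x := by
        by_contra h
        exact hx'.1 (subset_closure h)
      have h2 : ξ x = 0 := image_eq_zero_of_notMem_tsupport hx'.2
      exact hx (by rw [hval, h1, h2, smul_zero, add_zero])
  have hev : ∀ᶠ t : ℝ in 𝓝 0, ‖t‖₊ * L < 1 := by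
    have hc : Continuous fun t : ℝ => ‖t‖₊ * L := by fun_prop
    exact hc.continuousAt.eventually_lt continuousAt_const (by simp)
  classical
  refine ⟨fun t => if h : ‖t‖₊ * L < 1 then (key t h).choose else φ, ?_⟩
  filter_upwards [hev] with t ht
  simp only [dif_pos ht]
  exact (key t ht).choose_spec

/-! ### The distance to the image of `S` -/

theorem mul_distImage_le {n : ℕ} {S : Set (Eucl n)} (hS : S.Nonempty) {φ : Diff1c n} {x : Eucl n}
    {c d : ℝ} (hc : 0 < c) (h : ∀ s ∈ S, d ≤ c * ‖φ x - φ s‖) : d ≤ c * distImage S φ x := by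
  rw [← div_le_iff₀' hc, distImage, Metric.le_infDist (hS.image _)]
  rintro _ ⟨s, hs, rfl⟩
  rw [div_le_iff₀' hc, dist_eq_norm]
  exact h s hs

theorem distImage_le {n : ℕ} {S : Set (Eucl n)} {φ : Diff1c n} {x s : Eucl n} (hs : s ∈ S) :
    distImage S φ x ≤ ‖φ x - φ s‖ := by
  rw [← dist_eq_norm]
  exact Metric.infDist_le_dist_of_mem (Set.mem_image_of_mem _ hs)

theorem distImage_nonneg {n : ℕ} (S : Set (Eucl n)) (φ : Diff1c n) (x : Eucl n) :
    0 ≤ distImage S φ x := Metric.infDist_nonneg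

theorem continuous_distImage {n : ℕ} (S : Set (Eucl n)) (φ : Diff1c n) :
    Continuous (distImage S φ) :=
  (Metric.continuous_infDist_pt _).comp φ.toHomeomorph.continuous

theorem exists_isNearest {n : ℕ} {S : Set (Eucl n)} (hS : IsCompact S) (hne : S.Nonempty)
    (φ : Diff1c n) (x : Eucl n) : ∃ s, IsNearest S φ x s := by
  obtain ⟨_, ⟨s, hs, rfl⟩, h⟩ :=
    (hS.image φ.toHomeomorph.continuous).exists_infDist_eq_dist (hne.image φ) (φ x)
  exact ⟨s, hs, by rw [← dist_eq_norm]; exact h⟩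

/-- This comparison lets Hardy's inequality control the singular weight for every `φ`. -/
theorem exists_mul_infDist_compl_le {n : ℕ} {Ω S : Set (Eucl n)} (hne : S.Nonempty)
    (hSΩ : S ⊆ Ωᶜ) (φ : Diff1c n) :
    ∃ c : ℝ, 0 < c ∧ ∀ x, c * Metric.infDist x Ωᶜ ≤ distImage S φ x := by
  obtain ⟨c, hc, h⟩ := φ.exists_mul_norm_sub_le
  refine ⟨c, hc, fun x => ?_⟩
  rw [← one_mul (distImage S φ x)]
  refine mul_distImage_le hne one_pos fun s hs => ?_
  rw [one_mul]
  refine le_trans ?_ (h x s)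
  gcongr
  rw [← dist_eq_norm]
  exact Metric.infDist_le_dist_of_mem (hSΩ hs)

theorem distImage_pos {n : ℕ} {Ω S : Set (Eucl n)} (hΩ : IsOpen Ω) (hne : S.Nonempty)
    (hSΩ : S ⊆ Ωᶜ) (φ : Diff1c n) {x : Eucl n} (hx : x ∈ Ω) : 0 < distImage S φ x := by
  obtain ⟨c, hc, h⟩ := exists_mul_infDist_compl_le hne hSΩ φ
  exact (mul_pos hc ((hΩ.isClosed_compl.notMem_iff_infDist_pos (hne.mono hSΩ)).1
    fun h => h hx)).trans_le (h x)

/-- Almost every point has at most one nearest point: Rademacher's theorem. -/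
theorem ae_isNearest_unique {n : ℕ} (S : Set (Eucl n)) (φ : Diff1c n) :
    ∀ᵐ x, ∀ s t, IsNearest S φ x s → IsNearest S φ x t → s = t := by
  obtain ⟨L, hL⟩ := φ.exists_lipschitzWith
  have hlip : LipschitzWith (1 * L) (distImage S φ) := (Metric.lipschitz_infDist_pt _).comp hL
  filter_upwards [hlip.ae_differentiableAt (μ := volume)] with x hx
  have hsym : DifferentiableAt ℝ φ.toHomeomorph.symm (φ x) :=
    φ.contDiff_symm.differentiable one_ne_zero _
  -- Composing with φ⁻¹ transfers differentiability at `x` to the distance function at φ(x), so no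
  -- image of a null set needs to be considered.
  have hd : DifferentiableAt ℝ (fun y => Metric.infDist y (φ '' S)) (φ x) := by
    have h1 : DifferentiableAt ℝ (distImage S φ) (φ.toHomeomorph.symm (φ x)) := by simpa using hx
    have h2 := h1.comp (φ x) hsym
    have h3 : (fun y => Metric.infDist y (φ '' S)) = distImage S φ ∘ φ.toHomeomorph.symm := by
      ext y
      simp [distImage]
    rw [h3]
    exact h2
  have key : ∀ s, IsNearest S φ x s → ∀ v,
      fderiv ℝ (fun y => Metric.infDist y (φ '' S) ^ 2) (φ x) v = 2 * inner ℝ (φ x - φ s) v := by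
    intro s hs v
    have h1 : HasFDerivAt (fun y => Metric.infDist y (φ '' S) ^ 2 - ‖y - φ s‖ ^ 2)
        (fderiv ℝ (fun y => Metric.infDist y (φ '' S) ^ 2) (φ x) - 2 • innerSL ℝ (φ x - φ s))
        (φ x) := by
      refine (hd.pow 2).hasFDerivAt.sub ?_
      simpa using ((hasFDerivAt_id (φ x)).sub_const (φ s)).norm_sq
    -- The difference is nonpositive everywhere and vanishes at φ(x). Hence the gradient of the
    -- squared distance is 2(φ(x) - φ(s)), which determines `s`.
    have h2 : IsLocalMax (fun y => Metric.infDist y (φ '' S) ^ 2 - ‖y - φ s‖ ^ 2) (φ x) := by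
      refine Eventually.of_forall fun y => ?_
      have e1 : Metric.infDist (φ x) (φ '' S) = ‖φ x - φ s‖ := hs.2
      have e2 : Metric.infDist y (φ '' S) ≤ ‖y - φ s‖ := by
        rw [← dist_eq_norm]
        exact Metric.infDist_le_dist_of_mem (Set.mem_image_of_mem _ hs.1)
      have e3 : Metric.infDist y (φ '' S) ^ 2 ≤ ‖y - φ s‖ ^ 2 := by
        have := Metric.infDist_nonneg (x := y) (s := φ '' S)
        gcongr
      simp only [e1]
      linarith
    have h3 := DFunLike.congr_fun (h2.hasFDerivAt_eq_zero h1) v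
    simpa [sub_eq_zero, inner_sub_left] using h3
  intro s t hs ht
  have h1 : ∀ v, inner ℝ (φ x - φ s) v = inner ℝ (φ x - φ t) v := fun v => by
    have := (key s hs v).symm.trans (key t ht v)
    linarith
  have h2 := ext_inner_right ℝ h1
  exact φ.toHomeomorph.injective (sub_right_injective h2)

/-! ### The integrand of the weighted integral -/

theorem aestronglyMeasurable_integrand {n : ℕ} {Ω : Set (Eucl n)} (S : Set (Eucl n))
    {u ρ : Eucl n → ℝ} (hu : MemH10 Ω u) (hρ : MemLp ρ ⊤ (volume.restrict Ω)) (φ : Diff1c n) :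
    AEStronglyMeasurable (fun x => u x ^ 2 * ρ x / distImage S φ x ^ 2) (volume.restrict Ω) :=
  (((hu.1.1.aemeasurable.pow_const 2).mul hρ.1.aemeasurable).div
    ((continuous_distImage S φ).measurable.pow_const 2).aemeasurable).aestronglyMeasurable

theorem integrableOn_integrand {n : ℕ} {Ω S : Set (Eucl n)} (hΩ : IsBoundedLipschitzDomain Ω)
    (hne : S.Nonempty) (hSΩ : S ⊆ Ωᶜ) {u ρ : Eucl n → ℝ} (hu : MemH10 Ω u)
    (hρ : MemLp ρ ⊤ (volume.restrict Ω)) (φ : Diff1c n) :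
    IntegrableOn (fun x => u x ^ 2 * ρ x / distImage S φ x ^ 2) Ω := by
  obtain ⟨c, hc, hcd⟩ := exists_mul_infDist_compl_le hne hSΩ φ
  have hI := integrableOn_sq_div_infDist hΩ (hne.mono hSΩ) hu
  set M := (eLpNormEssSup ρ (volume.restrict Ω)).toReal
  have hM : ∀ᵐ x ∂volume.restrict Ω, |ρ x| ≤ M := by
    have htop : eLpNormEssSup ρ (volume.restrict Ω) ≠ ⊤ := by
      have := hρ.2.ne
      rwa [eLpNorm_exponent_top] at this
    filter_upwards [enorm_ae_le_eLpNormEssSup ρ (volume.restrict Ω)] with x hx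
    have := ENNReal.toReal_mono htop hx
    simpa using this
  refine (hI.const_mul (M * (c ^ 2)⁻¹)).mono' (aestronglyMeasurable_integrand S hu hρ φ) ?_
  filter_upwards [hM, ae_restrict_mem hΩ.isOpen.measurableSet] with x hx hxΩ
  have hd : 0 < Metric.infDist x Ωᶜ :=
    (hΩ.isOpen.isClosed_compl.notMem_iff_infDist_pos (hne.mono hSΩ)).1 fun h => h hxΩ
  have hD := distImage_pos hΩ.isOpen hne hSΩ φ hxΩ
  have hle : (c * Metric.infDist x Ωᶜ) ^ 2 ≤ distImage S φ x ^ 2 := by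
    have := hcd x
    gcongr
  rw [norm_div, norm_mul, Real.norm_eq_abs, Real.norm_eq_abs, Real.norm_eq_abs, abs_sq, abs_sq]
  calc u x ^ 2 * |ρ x| / distImage S φ x ^ 2 ≤ u x ^ 2 * M / (c * Metric.infDist x Ωᶜ) ^ 2 := by
        gcongr
    _ = M * (c ^ 2)⁻¹ * (u x / Metric.infDist x Ωᶜ) ^ 2 := by
        field_simp

/-- If `ψ - φ` is Lipschitz relative to `φ` with constant `δ`, the integrands at `ψ` and `φ` differ
by a relative error of order `δ`. -/
theorem abs_integrand_sub_le {n : ℕ} {S : Set (Eucl n)} (hne : S.Nonempty) (w : ℝ)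
    {φ ψ : Diff1c n} {x : Eucl n} {δ : ℝ} (h0 : 0 ≤ δ) (h1 : δ ≤ 1 / 2)
    (h : ∀ s ∈ S, ‖(ψ x - φ x) - (ψ s - φ s)‖ ≤ δ * ‖φ x - φ s‖) :
    |w / distImage S ψ x ^ 2 - w / distImage S φ x ^ 2| ≤ 10 * δ * |w / distImage S φ x ^ 2| := by
  -- The two distances satisfy (1 - δ)a ≤ b ≤ (1 + δ)a; the factor 10 then follows from (1 - 10δ)(1
  -- + δ)² ≤ 1 ≤ (1 + 10δ)(1 - δ)² for 0 ≤ δ ≤ 1/2.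
  have hlo : (1 - δ) * distImage S φ x ≤ distImage S ψ x := by
    rw [← one_mul (distImage S ψ x)]
    refine mul_distImage_le hne one_pos fun s hs => ?_
    have e1 : φ x - φ s = (ψ x - ψ s) - ((ψ x - φ x) - (ψ s - φ s)) := by abel
    have e2 : ‖φ x - φ s‖ ≤ ‖ψ x - ψ s‖ + ‖(ψ x - φ x) - (ψ s - φ s)‖ := by
      conv_lhs => rw [e1]
      exact norm_sub_le _ _
    have e3 := mul_le_mul_of_nonneg_left (distImage_le hs : distImage S φ x ≤ _)
      (by linarith : 0 ≤ 1 - δ)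
    linarith [h s hs]
  have hhi : distImage S ψ x ≤ (1 + δ) * distImage S φ x := by
    refine mul_distImage_le hne (by linarith) fun s hs => (distImage_le hs).trans ?_
    have e1 : ψ x - ψ s = (φ x - φ s) + ((ψ x - φ x) - (ψ s - φ s)) := by abel
    have e2 : ‖ψ x - ψ s‖ ≤ ‖φ x - φ s‖ + ‖(ψ x - φ x) - (ψ s - φ s)‖ := by
      conv_lhs => rw [e1]
      exact norm_add_le _ _
    linarith [h s hs]
  have hn := distImage_nonneg S φ x
  set a := distImage S φ x
  set b := distImage S ψ x
  rcases hn.eq_or_lt with ha | ha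
  · rw [← ha] at hlo hhi ⊢
    have hb : b = 0 := by linarith
    simp [hb]
  · have hb : 0 < b := lt_of_lt_of_le (by nlinarith) hlo
    have e1 : w / b ^ 2 - w / a ^ 2 = (a ^ 2 / b ^ 2 - 1) * (w / a ^ 2) := by
      field_simp
    rw [e1, abs_mul]
    gcongr
    rw [abs_le]
    constructor
    · rw [le_sub_iff_add_le, le_div_iff₀ (by positivity)]
      have : b ^ 2 ≤ ((1 + δ) * a) ^ 2 := by gcongr
      by_cases h10 : -(10 * δ) + 1 ≤ 0
      · nlinarith [sq_nonneg a, sq_nonneg b]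
      · have h3 : (-(10 * δ) + 1) * b ^ 2 ≤ (-(10 * δ) + 1) * ((1 + δ) * a) ^ 2 := by
          gcongr
          linarith
        have h4 : (-(10 * δ) + 1) * (1 + δ) ^ 2 ≤ 1 := by
          nlinarith [mul_nonneg h0 h0, mul_nonneg h0 (mul_nonneg h0 h0)]
        nlinarith [sq_nonneg a]
    · rw [sub_le_iff_le_add, div_le_iff₀ (by positivity)]
      have h2 : ((1 - δ) * a) ^ 2 ≤ b ^ 2 := by
        have : 0 ≤ (1 - δ) * a := mul_nonneg (by linarith) ha.le
        gcongr
      have h3 : (10 * δ + 1) * ((1 - δ) * a) ^ 2 ≤ (10 * δ + 1) * b ^ 2 := by gcongr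
      have h4 : 1 ≤ (10 * δ + 1) * (1 - δ) ^ 2 := by
        nlinarith [mul_nonneg h0 h0, mul_nonneg h0 (sub_nonneg.2 h1)]
      nlinarith [sq_nonneg a]

theorem continuous_weightedIntegral {n : ℕ} {Ω S : Set (Eucl n)} (hΩ : IsBoundedLipschitzDomain Ω)
    (hne : S.Nonempty) (hSΩ : S ⊆ Ωᶜ) (hSb : Bornology.IsBounded S) {u ρ : Eucl n → ℝ}
    (hu : MemH10 Ω u) (hρ : MemLp ρ ⊤ (volume.restrict Ω)) :
    Continuous (weightedIntegral Ω S u ρ) := by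
  rw [continuous_iff_continuousAt]
  intro φ
  have hint := fun ψ : Diff1c n => integrableOn_integrand hΩ hne hSΩ hu hρ ψ
  obtain ⟨c, hc, hcφ⟩ := φ.exists_mul_norm_sub_le
  set I := ∫ x in Ω, |u x ^ 2 * ρ x / distImage S φ x ^ 2| with hI
  have hI0 : 0 ≤ I := integral_nonneg fun x => abs_nonneg _
  rw [ContinuousAt, Metric.tendsto_nhds]
  intro ε hε
  set δ := min (1 / 2) (ε / (20 * (I + 1))) with hδ
  have hδ0 : 0 < δ := lt_min (by norm_num) (by positivity)
  have hδI : 10 * δ * I < ε := by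
    have h1 : δ ≤ ε / (20 * (I + 1)) := min_le_right _ _
    rw [le_div_iff₀ (by positivity)] at h1
    nlinarith
  -- Closeness δc, divided by the lower Lipschitz constant c of φ, becomes closeness δ relative to
  -- |φ(x) - φ(s)|.
  filter_upwards [eventually_norm_sub_le φ (hΩ.isBounded.union hSb) (mul_pos hδ0 hc)] with ψ hψ
  rw [Real.dist_eq, weightedIntegral, weightedIntegral, ← integral_sub (hint ψ) (hint φ)]
  refine lt_of_le_of_lt ?_ hδI
  rw [hI, ← integral_const_mul]
  refine abs_integral_le_integral_abs.trans (integral_mono_of_nonneg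
    ?_ ((hint φ).abs.const_mul _) ?_)
  · exact ae_of_all _ fun x => abs_nonneg _
  filter_upwards [ae_restrict_mem hΩ.isOpen.measurableSet] with x hx
  refine abs_integrand_sub_le hne _ hδ0.le (min_le_left _ _) fun s hs => ?_
  refine (hψ x (Or.inl hx) s (Or.inr hs)).trans ?_
  rw [mul_assoc]
  gcongr
  exact hcφ x s

/-! ### The directional derivative -/

/-- Differentiation of a minimum of functions `A s + t B s + t² C s` at a point where the minimizer
is unique. -/
theorem hasDerivAt_min_of_unique {X : Type*} [TopologicalSpace X] {S : Set X} (hS : IsCompact S)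
    {A B C : X → ℝ} (hA : Continuous A) (hB : Continuous B) (hC : Continuous C) {M : ℝ → ℝ}
    {s₀ : X} (hs₀ : s₀ ∈ S) (hmin : ∀ s ∈ S, A s₀ ≤ A s) (huniq : ∀ s ∈ S, A s = A s₀ → s = s₀)
    (hM : ∀ᶠ t in 𝓝 (0 : ℝ), (∀ s ∈ S, M t ≤ A s + t * B s + t ^ 2 * C s) ∧
      ∃ s ∈ S, M t = A s + t * B s + t ^ 2 * C s) :
    HasDerivAt M (B s₀) 0 := by
  obtain ⟨b, hb⟩ := hS.exists_bound_of_continuousOn hB.continuousOn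
  obtain ⟨c, hc⟩ := hS.exists_bound_of_continuousOn hC.continuousOn
  have hM0 : M 0 = A s₀ := by
    obtain ⟨h1, s, hs, h2⟩ := hM.self_of_nhds
    have h3 := h1 s₀ hs₀
    have h4 := hmin s hs
    simp only [zero_mul, add_zero, ne_eq, OfNat.ofNat_ne_zero, not_false_eq_true, zero_pow] at h2 h3
    linarith
  classical
  -- A choice of minimizer at time `t`; no continuity is built in.
  let τ : ℝ → X := fun t =>
    if h : ∃ s ∈ S, M t = A s + t * B s + t ^ 2 * C s then h.choose else s₀
  have hτS : ∀ t, τ t ∈ S := fun t => by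
    by_cases h : ∃ s ∈ S, M t = A s + t * B s + t ^ 2 * C s
    · simp only [τ, dif_pos h]
      exact h.choose_spec.1
    · simp only [τ, dif_neg h]
      exact hs₀
  have hτM : ∀ᶠ t in 𝓝 (0 : ℝ), (∀ s ∈ S, M t ≤ A s + t * B s + t ^ 2 * C s) ∧
      M t = A (τ t) + t * B (τ t) + t ^ 2 * C (τ t) := by
    filter_upwards [hM] with t ht
    refine ⟨ht.1, ?_⟩
    simp only [τ, dif_pos ht.2]
    exact ht.2.choose_spec.2
  have hAτ : Tendsto (fun t => A (τ t)) (𝓝 0) (𝓝 (A s₀)) := by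
    have hlim : Tendsto (fun t : ℝ => A s₀ + (|t| * (2 * b) + t ^ 2 * (2 * c))) (𝓝 0)
        (𝓝 (A s₀)) := by
      have : Continuous fun t : ℝ => A s₀ + (|t| * (2 * b) + t ^ 2 * (2 * c)) := by fun_prop
      simpa using this.tendsto 0
    refine tendsto_of_tendsto_of_tendsto_of_le_of_le' tendsto_const_nhds hlim
      (Eventually.of_forall fun t => hmin _ (hτS t)) ?_
    filter_upwards [hτM] with t ht
    have h1 := ht.1 s₀ hs₀
    rw [ht.2] at h1
    have h2 : t * B s₀ - t * B (τ t) ≤ |t| * (2 * b) := by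
      rw [← mul_sub]
      refine (le_abs_self _).trans ?_
      rw [abs_mul]
      gcongr
      have := hb s₀ hs₀
      have := hb _ (hτS t)
      rw [Real.norm_eq_abs] at *
      linarith [abs_sub (B s₀) (B (τ t))]
    have h3 : t ^ 2 * C s₀ - t ^ 2 * C (τ t) ≤ t ^ 2 * (2 * c) := by
      rw [← mul_sub]
      gcongr
      have := abs_le.1 (hc s₀ hs₀)
      have := abs_le.1 (hc _ (hτS t))
      linarith
    linarith
  -- Every cluster point of the minimizers in the compact `S` minimizes `A`, so uniqueness forces
  -- convergence to `s₀`.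
  have hτ : Tendsto τ (𝓝 0) (𝓝 s₀) := by
    refine hS.tendsto_nhds_of_unique_mapClusterPt (Eventually.of_forall hτS) fun y hy hcl => ?_
    refine huniq y hy ?_
    have h1 : MapClusterPt (A y) (𝓝 0) (A ∘ τ) := hcl.continuousAt_comp hA.continuousAt
    exact @eq_of_nhds_neBot _ _ _ _ _ (ClusterPt.mono h1 hAτ)
  have hBτ : Tendsto (fun t => B (τ t)) (𝓝 0) (𝓝 (B s₀)) := (hB.tendsto _).comp hτ
  rw [hasDerivAt_iff_isLittleO_nhds_zero]
  -- Testing with `s₀` bounds M(t) above, and A(τ) ≥ A(s₀) bounds it below. The error in the linear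
  -- term is thus at most |t| |B(τ) - B(s₀)| + c t².
  have hlittle : (fun t : ℝ => t * (|B (τ t) - B s₀| + |t| * c)) =o[𝓝 0] fun t => t := by
    have h0 : Tendsto (fun t => |B (τ t) - B s₀| + |t| * c) (𝓝 0) (𝓝 0) := by
      have h1 : Tendsto (fun t => |B (τ t) - B s₀|) (𝓝 0) (𝓝 0) := by
        simpa using (hBτ.sub_const (B s₀)).abs
      have h2 : Tendsto (fun t : ℝ => |t| * c) (𝓝 0) (𝓝 0) := by
        have : Continuous fun t : ℝ => |t| * c := by fun_prop
        simpa using this.tendsto 0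
      simpa using h1.add h2
    simpa using (Asymptotics.isBigO_refl (fun t : ℝ => t) (𝓝 0)).mul_isLittleO
      ((Asymptotics.isLittleO_one_iff ℝ).2 h0)
  refine Asymptotics.IsBigO.trans_isLittleO (Asymptotics.IsBigO.of_bound 1 ?_) hlittle
  filter_upwards [hτM] with t ht
  have h1 := ht.1 s₀ hs₀
  have h2 := hmin _ (hτS t)
  have hc1 := abs_le.1 (hc s₀ hs₀)
  have hc2 := abs_le.1 (hc _ (hτS t))
  rw [zero_add, hM0, smul_eq_mul, one_mul, Real.norm_eq_abs, Real.norm_eq_abs, abs_mul,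
    abs_of_nonneg (a := |B (τ t) - B s₀| + |t| * c)
      (add_nonneg (abs_nonneg _) (mul_nonneg (abs_nonneg _) ((norm_nonneg _).trans (hc s₀ hs₀)))),
    mul_add, ← abs_mul, ← mul_assoc, ← abs_mul t t, abs_mul_self]
  have h3 := abs_le.1 (le_refl |t * (B (τ t) - B s₀)|)
  have h4 : t ^ 2 * C s₀ ≤ t ^ 2 * c := by gcongr; exact hc1.2
  have h5 : t ^ 2 * (-c) ≤ t ^ 2 * C (τ t) := by gcongr; exact hc2.1
  have h6 := abs_nonneg (t * (B (τ t) - B s₀))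
  rw [abs_le]
  constructor
  · rw [ht.2]; nlinarith [h3.1]
  · nlinarith

/-- Squared distances along φ + tξ are exactly quadratic in t, so the minimum rule applies to the
squared distance and the quotient rule finishes. -/
theorem hasDerivAt_integrand {n : ℕ} {S : Set (Eucl n)} (hS : IsCompact S) {φ : Diff1c n}
    {ξ : Eucl n → Eucl n} (hξ : Continuous ξ) {γ : ℝ → Diff1c n}
    (hγ : ∀ᶠ t in 𝓝 (0 : ℝ), ∀ x, γ t x = φ x + t • ξ x) {x s₀ : Eucl n}
    (hs₀ : IsNearest S φ x s₀) (huniq : ∀ s, IsNearest S φ x s → s = s₀)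
    (hpos : 0 < distImage S φ x) (u ρ : Eucl n → ℝ) {σ : Eucl n → Eucl n} (hσ : σ x = s₀) :
    HasDerivAt (fun t => u x ^ 2 * ρ x / distImage S (γ t) x ^ 2)
      (-2 * derivIntegrand S u ρ φ σ ξ x) 0 := by
  have hφc : Continuous φ := φ.toHomeomorph.continuous
  have hquad : ∀ t, (∀ x, γ t x = φ x + t • ξ x) → ∀ s, ‖γ t x - γ t s‖ ^ 2 =
      ‖φ x - φ s‖ ^ 2 + t * (2 * inner ℝ (φ x - φ s) (ξ x - ξ s)) + t ^ 2 * ‖ξ x - ξ s‖ ^ 2 := by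
    intro t ht s
    rw [ht, ht, show φ x + t • ξ x - (φ s + t • ξ s) = (φ x - φ s) + t • (ξ x - ξ s) by
      rw [smul_sub]; abel, norm_add_sq_real, inner_smul_right, norm_smul, mul_pow,
      Real.norm_eq_abs, sq_abs]
    ring
  have hder : HasDerivAt (fun t => distImage S (γ t) x ^ 2)
      (2 * inner ℝ (φ x - φ s₀) (ξ x - ξ s₀)) 0 := by
    refine hasDerivAt_min_of_unique hS (A := fun s => ‖φ x - φ s‖ ^ 2)
      (B := fun s => 2 * inner ℝ (φ x - φ s) (ξ x - ξ s)) (C := fun s => ‖ξ x - ξ s‖ ^ 2)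
      (by fun_prop) (by fun_prop) (by fun_prop) hs₀.1 ?_ ?_ ?_
    · intro s hs
      have h1 : ‖φ x - φ s₀‖ ≤ ‖φ x - φ s‖ := hs₀.2.symm.trans_le (distImage_le hs)
      gcongr
    · intro s hs h
      refine huniq s ⟨hs, ?_⟩
      rw [hs₀.2]
      exact ((sq_eq_sq₀ (norm_nonneg _) (norm_nonneg _)).1 h).symm
    · filter_upwards [hγ] with t ht
      constructor
      · intro s hs
        rw [← hquad t ht]
        have := distImage_nonneg S (γ t) x
        have := distImage_le (φ := γ t) (x := x) hs
        gcongr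
      · obtain ⟨s, hs, h⟩ := exists_isNearest hS ⟨s₀, hs₀.1⟩ (γ t) x
        exact ⟨s, hs, by rw [← hquad t ht, h]⟩
  have h0 : distImage S (γ 0) x = distImage S φ x := by
    have : (γ 0 : Eucl n → Eucl n) = φ := by
      ext1 y
      simpa using hγ.self_of_nhds y
    rw [distImage, distImage, this]
  have hne : distImage S (γ 0) x ^ 2 ≠ 0 := by rw [h0]; positivity
  refine ((hasDerivAt_const (0 : ℝ) (u x ^ 2 * ρ x)).div hder hne).congr_deriv ?_
  rw [h0, derivIntegrand, hσ]
  ring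

/-- The directional derivative of the weighted integral. -/
theorem hasDirectionalDeriv_weightedIntegral {n : ℕ} {Ω S : Set (Eucl n)}
    (hΩ : IsBoundedLipschitzDomain Ω) (hS : IsCompact S) (hne : S.Nonempty) (hSΩ : S ⊆ Ωᶜ)
    {u ρ : Eucl n → ℝ} (hu : MemH10 Ω u) (hρ : MemLp ρ ⊤ (volume.restrict Ω)) (φ : Diff1c n)
    {σ : Eucl n → Eucl n} (hσ : ∀ᵐ x ∂volume.restrict Ω, IsNearest S φ x (σ x))
    {ξ : Eucl n → Eucl n} (hξ : IsC1cField ξ) :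
    IntegrableOn (derivIntegrand S u ρ φ σ ξ) Ω ∧
      HasDirectionalDeriv (weightedIntegral Ω S u ρ) φ ξ
        (-2 * ∫ x in Ω, derivIntegrand S u ρ φ σ ξ x) := by
  obtain ⟨γ, hγ⟩ := φ.exists_add_smul hξ
  obtain ⟨c, hc, hcφ⟩ := φ.exists_mul_norm_sub_le
  obtain ⟨L, hL⟩ := hξ.contDiff.lipschitzWith_of_hasCompactSupport hξ.hasCompactSupport one_ne_zero
  have hξφ : ∀ x y, ‖ξ x - ξ y‖ ≤ L / c * ‖φ x - φ y‖ := fun x y => by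
    refine (hL.norm_sub_le x y).trans ?_
    rw [div_mul_eq_mul_div, le_div_iff₀ hc, mul_assoc, mul_comm ‖x - y‖]
    gcongr
    exact hcφ x y
  have hint := fun ψ : Diff1c n => integrableOn_integrand hΩ hne hSΩ hu hρ ψ
  set w : Diff1c n → Eucl n → ℝ := fun ψ x => u x ^ 2 * ρ x / distImage S ψ x ^ 2 with hw
  have hγ0 : (γ 0 : Eucl n → Eucl n) = φ := by
    ext1 y
    simpa using hγ.self_of_nhds y
  have hw0 : w (γ 0) = w φ := by
    ext1 x
    simp only [hw, distImage, hγ0]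
  have hderiv : ∀ᵐ x ∂volume.restrict Ω,
      HasDerivAt (fun t => w (γ t) x) (-2 * derivIntegrand S u ρ φ σ ξ x) 0 := by
    filter_upwards [ae_restrict_mem hΩ.isOpen.measurableSet, hσ,
      ae_restrict_of_ae (ae_isNearest_unique S φ)] with x hx hσx hux
    exact hasDerivAt_integrand hS hξ.contDiff.continuous hγ hσx (fun s hs => hux s _ hs hσx)
      (distImage_pos hΩ.isOpen hne hSΩ φ hx) u ρ rfl
  have hslope : ∀ᵐ x ∂volume.restrict Ω, Tendsto (fun t => t⁻¹ • (w (γ t) x - w φ x)) (𝓝[≠] 0)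
      (𝓝 (-2 * derivIntegrand S u ρ φ σ ξ x)) := by
    filter_upwards [hderiv] with x hx
    have := hasDerivAt_iff_tendsto_slope_zero.1 hx
    simpa only [zero_add, hw0] using this
  have hbound : ∀ᶠ t in 𝓝[≠] (0 : ℝ), ∀ x,
      ‖t⁻¹ • (w (γ t) x - w φ x)‖ ≤ 10 * (L / c) * |w φ x| := by
    have hsmall : ∀ᶠ t : ℝ in 𝓝 0, |t| * (L / c) ≤ 1 / 2 := by
      have hcont : Continuous fun t : ℝ => |t| * (L / c) := by fun_prop
      have := hcont.continuousAt.eventually_lt (x₀ := 0) (continuousAt_const (y := (1 / 2 : ℝ)))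
        (by norm_num)
      exact this.mono fun t ht => ht.le
    filter_upwards [nhdsWithin_le_nhds hγ, nhdsWithin_le_nhds hsmall, self_mem_nhdsWithin]
      with t ht ht2 ht0 x
    -- Here δ = |t| L/c, so dividing by |t| leaves a bound independent of `t`.
    have h1 := abs_integrand_sub_le hne (u x ^ 2 * ρ x) (φ := φ) (ψ := γ t) (x := x)
      (by positivity) ht2 fun s _ => by
        rw [ht, ht, add_sub_cancel_left, add_sub_cancel_left, ← smul_sub, norm_smul, mul_assoc,
          Real.norm_eq_abs]
        gcongr
        exact hξφ x s
    have ht0' : 0 < |t| := abs_pos.2 ht0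
    rw [norm_smul, norm_inv, Real.norm_eq_abs, Real.norm_eq_abs, inv_mul_le_iff₀ ht0']
    refine h1.trans (le_of_eq ?_)
    ring
  have hD : Integrable (fun x => -2 * derivIntegrand S u ρ φ σ ξ x) (volume.restrict Ω) := by
    refine ((hint φ).abs.const_mul (10 * (L / c))).mono' ?_ ?_
    -- The selection `σ` need not be measurable: measurability comes from the integrand being an
    -- a.e. limit of difference quotients.
    · exact aestronglyMeasurable_of_tendsto_ae (𝓝[≠] (0 : ℝ))
        (fun t => (((hint (γ t)).sub (hint φ)).smul t⁻¹).aestronglyMeasurable) hslope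
    · filter_upwards [hslope] with x hx
      exact le_of_tendsto hx.norm (hbound.mono fun t ht => ht x)
  refine ⟨?_, γ, hγ, ?_⟩
  · have := hD.const_mul (-2)⁻¹
    refine this.congr (ae_of_all _ fun x => ?_)
    simp
  · rw [hasDerivAt_iff_tendsto_slope_zero, ← integral_const_mul]
    have hlim := tendsto_integral_filter_of_dominated_convergence
      (fun x => 10 * (L / c) * |w φ x|)
      (Eventually.of_forall fun t : ℝ =>
        (((hint (γ t)).sub (hint φ)).smul t⁻¹).aestronglyMeasurable)
      (hbound.mono fun t ht => ae_of_all _ ht) ((hint φ).abs.const_mul _) hslope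
    refine hlim.congr fun t => ?_
    have h0 : weightedIntegral Ω S u ρ (γ 0) = ∫ x in Ω, w φ x := by rw [← hw0]; rfl
    rw [zero_add, h0, weightedIntegral, ← integral_sub (hint (γ t)) (hint φ), ← integral_smul]
    rfl

end HardyShape

theorem lemma4p2 (n : ℕ) (Ω S : Set (Eucl n)) (hΩ : IsBoundedLipschitzDomain Ω)
    (hS : IsClosed S) (hSne : S.Nonempty) (hSΩ : S ⊆ frontier Ω)
    (u ρ : Eucl n → ℝ) (hu : MemH10 Ω u) (hρ : MemLp ρ ⊤ (volume.restrict Ω)) :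
    (∀ φ : Diff1c n, IntegrableOn (fun x => u x ^ 2 * ρ x / distImage S φ x ^ 2) Ω) ∧
    GateauxDifferentiable (weightedIntegral Ω S u ρ) ∧
    ∀ φ : Diff1c n,
      (∀ᵐ x ∂volume.restrict Ω, ∃! s, IsNearest S φ x s) ∧
      ∀ σ : Eucl n → Eucl n, (∀ᵐ x ∂volume.restrict Ω, IsNearest S φ x (σ x)) →
        ∀ ξ : Eucl n → Eucl n, IsC1cField ξ →
          IntegrableOn (derivIntegrand S u ρ φ σ ξ) Ω ∧
          HasDirectionalDeriv (weightedIntegral Ω S u ρ) φ ξ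
            (-2 * ∫ x in Ω, derivIntegrand S u ρ φ σ ξ x) := by
  have hSc : S ⊆ Ωᶜ := fun s hs h => by
    have := hSΩ hs
    rw [hΩ.isOpen.frontier_eq] at this
    exact this.2 h
  have hScpt : IsCompact S :=
    hΩ.isBounded.isCompact_closure.of_isClosed_subset hS (hSΩ.trans frontier_subset_closure)
  refine ⟨integrableOn_integrand hΩ hSne hSc hu hρ,
    ⟨continuous_weightedIntegral hΩ hSne hSc hScpt.isBounded hu hρ, fun φ ξ hξ => ?_⟩,
    fun φ => ⟨?_, fun σ hσ ξ hξ =>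
      hasDirectionalDeriv_weightedIntegral hΩ hScpt hSne hSc hu hρ φ hσ hξ⟩⟩
  -- Any pointwise selection of nearest points serves to produce the derivative.
  · choose σ hσ using exists_isNearest hScpt hSne φ
    exact ⟨_, (hasDirectionalDeriv_weightedIntegral hΩ hScpt hSne hSc hu hρ φ
      (ae_of_all _ hσ) hξ).2⟩
  · filter_upwards [ae_restrict_of_ae (ae_isNearest_unique S φ)] with x hx
    obtain ⟨s, hs⟩ := exists_isNearest hScpt hSne φ x
    exact ⟨s, hs, fun t ht => hx t s ht hs⟩
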